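/- Consider a two-player game $G$ that is either (a) finite: each player $k$ has a nonempty finite action set $A_k$, her strategy set is the simplex $S_k=\Delta(A_k)$ of mixed actions, and payoffs are expected payoffs; or (b) an interval game: each $S_k$ is a nonempty compact interval of real numbers, and each payoff $\pi_k(s_k,s_l)$ ($l$ the opponent of $k$) is twice continuously differentiable on the product of the intervals and weakly concave in the player's own strategy $s_k$. A strategy $s_k$ is a best reply to $s_l$ if it maximizes $\pi_k(\cdot,s_l)$ on $S_k$; it is undominated if it is a best reply to some strategy of the opponent. $BR(s_i)\subseteq S_j$ denotes the set of best replies of the opponent $j$ of $i$ to $s_i$. An undominated Stackelberg strategy of $i$ is an undominated strategy that maximizes $\max_{s_j\in BR(s_i)}\pi_i(s_i,s_j)$ over the undominated strategies $s_i$ of $i$. A biased belief of player $k$ is a continuous map $\psi_k:S_l\to S_l$. It is blind if it is constant, and undistorted if it is the identity $Id$. It is monotone if it is weakly increasing (interval games), respectively if $\psi_k((1-\alpha)s_l+\alpha a)(a')\le\psi_k(s_l)(a')$ for all $\alpha\in[0,1]$, $s_l\in S_l$ and actions $a'\neq a$ of $l$ (finite games). $NE(G_\psi)$ is the set of profiles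 $(s_1,s_2)$ in which each $s_k$ is a best reply to $\psi_k(s_l)$. A pair $(\psi^*,s^*)$ is a weak BBE (biased-belief equilibrium) if $s^*\in NE(G_{\psi^*})$ and for each player $k$ and each biased belief $\psi'_k$ some $s'\in NE(G_{(\psi'_k,\psi^*_l)})$ satisfies $\pi_k(s')\le\pi_k(s^*)$. An $s'\in NE(G_{(\psi'_k,\psi_l^*)})$ is implausible if $\psi^*_l(s'_k)=\psi^*_l(s^*_k)$, $s'_l\ne s^*_l$ and $(s'_k,s^*_l)\in NE(G_{(\psi'_k,\psi^*_l)})$. A weak BBE is a BBE if both $\psi^*_1,\psi_2^*$ are monotone and for each $k$ and $\psi'_k$ some $s'\in NE(G_{(\psi'_k,\psi^*_l)})$ that is not implausible satisfies $\pi_k(s')\le\pi_k(s^*)$. It is a strong BBE if both $\psi^*_1,\psi_2^*$ are monotone and $\pi_k(s')\le\pi_k(s^*)$ for each $k$, each $\psi'_k$ and every $s'\in NE(G_{(\psi'_k,\psi^*_l)})$. Then, for each player $i$ with opponent $j$, $G$ admits a BBE $((\psi_i^*,Id),(s_i^*,s_j^*))$ such that (1) $\psi_i^*$ is blind, (2)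 $s_i^*$ is an undominated Stackelberg strategy of $i$, and (3) $s_j^*$ maximizes $\pi_i(s_i^*,\cdot)$ over $BR(s_i^*)$. In fact, for every profile $(s_i^*,s_j^*)$ satisfying (2) and (3) there is a blind $\psi_i^*$ such that $((\psi_i^*,Id),(s_i^*,s_j^*))$ is a BBE, and $\psi_i^*$ can moreover be chosen such that this BBE is strong if $s_i^*$ is the unique best reply of $i$ to some strategy of $j$. -/

import Mathlib

/-- The two players. -/
inductive Player : Type
  | one
  | two
  deriving DecidableEq

/-- The opponent of a player. -/
def Player.opp : Player → Player
  | Player.one => Player.two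
  | Player.two => Player.one

/-- A finite two-player game in pure actions: nonempty finite action sets, and for each player `i`
a payoff `u i a b`, where `a` is the action of `i` and `b` is the action of the opponent. -/
structure FiniteGame where
  Act : Player → Type
  fintypeAct : ∀ i, Fintype (Act i)
  nonemptyAct : ∀ i, Nonempty (Act i)
  u : ∀ i, Act i → Act i.opp → ℝ

attribute [instance] FiniteGame.fintypeAct FiniteGame.nonemptyAct

/-- An interval game: each player chooses a number in a nonempty compact interval; `u i x y` is the
payoff of player `i` who plays `x` against `y` (only its values on the intervals matter).
Payoffs are twice continuously differentiable, and concave in the player's own strategy. -/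
structure IntervalGame where
  lo : Player → ℝ
  hi : Player → ℝ
  lo_le_hi : ∀ i, lo i ≤ hi i
  u : Player → ℝ → ℝ → ℝ
  contDiff_u : ∀ i, ContDiffOn ℝ 2 (fun p : ℝ × ℝ => u i p.1 p.2)
    (Set.Icc (lo i) (hi i) ×ˢ Set.Icc (lo i.opp) (hi i.opp))
  concave_u : ∀ i, ∀ y ∈ Set.Icc (lo i.opp) (hi i.opp),
    ConcaveOn ℝ (Set.Icc (lo i) (hi i)) (fun x => u i x y)

/-- An underlying game is a finite game (played in mixed strategies) or an interval game. -/
inductive Game : Type 1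
  | finite (F : FiniteGame)
  | interval (I : IntervalGame)

namespace Game

/-- The set of strategies of a player: the simplex of mixed actions, or the interval. -/
def Strategy : Game → Player → Type
  | finite F, i => stdSimplex ℝ (F.Act i)
  | interval I, i => Set.Icc (I.lo i) (I.hi i)

/-- Strategy sets carry the subspace topology of `ℝ ^ A`, respectively of `ℝ`. -/
instance instTopologicalSpaceStrategy : ∀ (G : Game) (i : Player), TopologicalSpace (G.Strategy i)
  | finite F, i => inferInstanceAs (TopologicalSpace (stdSimplex ℝ (F.Act i)))
  | interval I, i => inferInstanceAs (TopologicalSpace (Set.Icc (I.lo i) (I.hi i)))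

/-- `G.payoff i x y` is the payoff of player `i` who plays `x` against the opponent's `y`;
in a finite game it is the expected payoff. -/
noncomputable def payoff : ∀ (G : Game) (i : Player), G.Strategy i → G.Strategy i.opp → ℝ
  | finite F, i => fun (x : stdSimplex ℝ (F.Act i)) (y : stdSimplex ℝ (F.Act i.opp)) =>
      ∑ a, ∑ b, x.1 a * y.1 b * F.u i a b
  | interval I, i => fun (x : Set.Icc (I.lo i) (I.hi i)) (y : Set.Icc (I.lo i.opp) (I.hi i.opp)) =>
      I.u i x.1 y.1

/-- A strategy profile. -/
abbrev Profile (G : Game) : Type := ∀ i, G.Strategy i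

/-- A biased belief of player `i`: a continuous self-map of the opponent's strategy set. -/
abbrev Belief (G : Game) (i : Player) : Type := C(G.Strategy i.opp, G.Strategy i.opp)

/-- Monotonicity of a self-map of the strategy set of player `j`. In an interval game it is weakly
increasing. In a finite game, when `s` is replaced by the mixture `t = (1 - α) • s + α • a` with a
pure action `a`, the perceived probability of each other action weakly decreases. -/
def MonotoneMap : ∀ (G : Game) (j : Player), (G.Strategy j → G.Strategy j) → Prop
  | finite F, j => fun (f : stdSimplex ℝ (F.Act j) → stdSimplex ℝ (F.Act j)) =>
      ∀ (s t : stdSimplex ℝ (F.Act j)) (a : F.Act j) (α : ℝ), 0 ≤ α → α ≤ 1 →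
        (∀ c, c ≠ a → t.1 c = (1 - α) * s.1 c) → t.1 a = (1 - α) * s.1 a + α →
        ∀ c, c ≠ a → (f t).1 c ≤ (f s).1 c
  | interval I, j => fun (f : Set.Icc (I.lo j) (I.hi j) → Set.Icc (I.lo j) (I.hi j)) =>
      Monotone f

variable (G : Game)

/-- The best replies of player `i` against the strategy `y` of the opponent. -/
def bestReplies (i : Player) (y : G.Strategy i.opp) : Set (G.Strategy i) :=
  {x | ∀ x', G.payoff i x' y ≤ G.payoff i x y}

/-- The best replies of the opponent of player `i` against the strategy `x` of player `i`. The
profile `p` only serves to present `x` as a strategy of `i.opp.opp`. -/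
def opponentReplies (i : Player) (x : G.Strategy i) : Set (G.Strategy i.opp) :=
  {y | ∃ p : G.Profile, p i = x ∧ p i.opp = y ∧ y ∈ G.bestReplies i.opp (p i.opp.opp)}

/-- The undominated strategies of player `i`: those that are a best reply to some strategy. -/
def undominated (i : Player) : Set (G.Strategy i) :=
  {x | ∃ y, x ∈ G.bestReplies i y}

/-- `y` is a best reply against `x`, and among these most favourable to player `i`. -/
def IsFavourableReply (i : Player) (x : G.Strategy i) (y : G.Strategy i.opp) : Prop :=
  y ∈ G.opponentReplies i x ∧ ∀ y' ∈ G.opponentReplies i x, G.payoff i x y' ≤ G.payoff i x y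

/-- `x` maximizes over the undominated strategies of player `i` the maximum of the payoff of `i`
over the best replies of the opponent. -/
def IsUndominatedStackelberg (i : Player) (x : G.Strategy i) : Prop :=
  x ∈ G.undominated i ∧ ∃ v, IsGreatest (G.payoff i x '' G.opponentReplies i x) v ∧
    ∀ x' ∈ G.undominated i, ∀ w ∈ G.payoff i x' '' G.opponentReplies i x', w ≤ v

variable {G}

/-- A belief is blind if the perceived strategy does not depend on the real strategy. -/
def IsBlind {i : Player} (b : G.Belief i) : Prop := ∀ y y', b y = b y'

/-- The payoff of player `i` in the biased game. -/
noncomputable def biasedPayoff (ψ : ∀ i, G.Belief i) (i : Player) (x : G.Strategy i)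
    (y : G.Strategy i.opp) : ℝ :=
  G.payoff i x (ψ i y)

/-- The Nash equilibria of the biased game. -/
def NE (ψ : ∀ i, G.Belief i) : Set G.Profile :=
  {s | ∀ i x, biasedPayoff ψ i x (s i.opp) ≤ biasedPayoff ψ i (s i) (s i.opp)}

/-- Weak biased-belief equilibrium. -/
def IsWeakBBE (ψ : ∀ i, G.Belief i) (s : G.Profile) : Prop :=
  s ∈ NE ψ ∧ ∀ (i : Player) (b : G.Belief i), ∃ s' ∈ NE (Function.update ψ i b),
    G.payoff i (s' i) (s' i.opp) ≤ G.payoff i (s i) (s i.opp)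

/-- Strong biased-belief equilibrium. -/
def IsStrongBBE (ψ : ∀ i, G.Belief i) (s : G.Profile) : Prop :=
  IsWeakBBE ψ s ∧ (∀ i, G.MonotoneMap i.opp (ψ i)) ∧
    ∀ (i : Player) (b : G.Belief i), ∀ s' ∈ NE (Function.update ψ i b),
      G.payoff i (s' i) (s' i.opp) ≤ G.payoff i (s i) (s i.opp)

/-- The equilibrium `s'` of the biased game after player `i` deviates to the belief `b` is
implausible: the opponent does not perceive a change, plays differently than before, and his
original strategy would also give an equilibrium. -/
def IsImplausible (ψ : ∀ i, G.Belief i) (s : G.Profile) (i : Player) (b : G.Belief i)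
    (s' : G.Profile) : Prop :=
  ψ i.opp (s' i.opp.opp) = ψ i.opp (s i.opp.opp) ∧ s i.opp ≠ s' i.opp ∧
    Function.update s' i.opp (s i.opp) ∈ NE (Function.update ψ i b)

/-- The plausible equilibria of the biased game after player `i` deviates to the belief `b`. -/
def PNE (ψ : ∀ i, G.Belief i) (s : G.Profile) (i : Player) (b : G.Belief i) : Set G.Profile :=
  {s' | s' ∈ NE (Function.update ψ i b) ∧ ¬ IsImplausible ψ s i b s'}

/-- Biased-belief equilibrium. -/
def IsBBE (ψ : ∀ i, G.Belief i) (s : G.Profile) : Prop :=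
  IsWeakBBE ψ s ∧ (∀ i, G.MonotoneMap i.opp (ψ i)) ∧
    ∀ (i : Player) (b : G.Belief i), ∃ s' ∈ PNE ψ s i b,
      G.payoff i (s' i) (s' i.opp) ≤ G.payoff i (s i) (s i.opp)

end Game

/-! Give `i` the constant belief in a strategy `y` to which `s i` is a best reply, and leave the
opponent undistorted. Whatever belief `i` deviates to, in any new equilibrium her strategy is a best
reply to something, hence undominated, and the undistorted opponent truly best-replies to it.
Stackelberg optimality therefore bounds her payoff in every new equilibrium. If the opponent
deviates, the blind `i` can stay at `s i`, and must do so when it is the only best reply to `y`.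
Against `s i` the opponent was already playing a true best reply, so nothing is gained
(`isBBE_of_stackelberg`).

Two existence statements remain. A Stackelberg profile exists because a continuous payoff attains
its maximum on a compact set (`exists_stackelberg_profile`). Harder is that every deviation of `i`
leaves some equilibrium, which follows from `NE_nonempty`: all biased games have one. Beliefs are
continuous and distort only the opponent's argument, so own-strategy concavity survives, and Ky
Fan's inequality applies to the Nikaido–Isoda function. That inequality comes from complementarity
on the simplex, the limit over ever finer grids of Scarf's lemma, itself a parity argument. -/

/-! ### Scarf's combinatorial lemma. -/

namespace Scarf

variable {T I L : Type*} [LinearOrder L]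

/-- No point exceeds all points of `σ` strictly in every direction from `C`. -/
def Dominant (r : I → T → L) (σ : Finset T) (C : Finset I) : Prop :=
  ∀ y, ∃ l ∈ C, ∀ x ∈ σ, r l y ≤ r l x

theorem Dominant.mono {r : I → T → L} {σ τ : Finset T} {C D : Finset I} (h : Dominant r σ C)
    (hτ : τ ⊆ σ) (hD : C ⊆ D) : Dominant r τ D := fun y =>
  let ⟨l, hl, hy⟩ := h y
  ⟨l, hD hl, fun x hx => hy x (hτ hx)⟩

theorem exists_argmin (r : I → T → L) {σ : Finset T} (hσ : σ.Nonempty) :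
    ∃ μ : I → T, ∀ l, μ l ∈ σ ∧ ∀ x ∈ σ, r l (μ l) ≤ r l x := by
  choose μ hμ using fun l => σ.exists_min_image (r l) hσ
  exact ⟨μ, hμ⟩

/-- Dominance applied to `x` itself yields a direction in which nothing in `σ` lies below `x`. -/
theorem Dominant.exists_argmin_eq {r : I → T → L} (hr : ∀ l, Function.Injective (r l))
    {σ : Finset T} {C : Finset I} (h : Dominant r σ C) {μ : I → T}
    (hμ : ∀ l, μ l ∈ σ ∧ ∀ x ∈ σ, r l (μ l) ≤ r l x) {x : T} (hx : x ∈ σ) :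
    ∃ l ∈ C, μ l = x := by
  obtain ⟨l, hl, h1⟩ := h x
  exact ⟨l, hl, hr l (le_antisymm ((hμ l).2 x hx) (h1 _ (hμ l).1))⟩

variable [DecidableEq T] [DecidableEq I]

omit [DecidableEq I] in
theorem Dominant.image_argmin {r : I → T → L} (hr : ∀ l, Function.Injective (r l))
    {σ : Finset T} {C : Finset I} (h : Dominant r σ C) {μ : I → T}
    (hμ : ∀ l, μ l ∈ σ ∧ ∀ x ∈ σ, r l (μ l) ≤ r l x) : C.image μ = σ := by
  ext x
  rw [Finset.mem_image]
  constructor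
  · rintro ⟨l, -, rfl⟩
    exact (hμ l).1
  · exact fun hx => h.exists_argmin_eq hr hμ hx

-- The argmin map is onto `σ`, and a surjection between finite sets of equal size is injective.
omit [DecidableEq I] in
theorem Dominant.injOn_argmin {r : I → T → L} (hr : ∀ l, Function.Injective (r l))
    {σ : Finset T} {C : Finset I} (h : Dominant r σ C) (hc : σ.card = C.card) {μ : I → T}
    (hμ : ∀ l, μ l ∈ σ ∧ ∀ x ∈ σ, r l (μ l) ≤ r l x) : Set.InjOn μ C := by
  rw [← Finset.card_image_iff, h.image_argmin hr hμ, hc]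

/-- A room has as many points as directions. -/
def IsRoom (r : I → T → L) (ρ : Finset T × Finset I) : Prop :=
  Dominant r ρ.1 ρ.2 ∧ ρ.1.card = ρ.2.card

/-- A door has one direction more than points. -/
def IsDoor (r : I → T → L) (δ : Finset T × Finset I) : Prop :=
  Dominant r δ.1 δ.2 ∧ δ.2.card = δ.1.card + 1

/-- Incidence of a door and a room. -/
def Incident (δ ρ : Finset T × Finset I) : Prop := δ.1 ⊆ ρ.1 ∧ ρ.2 ⊆ δ.2

/-- In `|δ.1| ≤ |ρ.1| = |ρ.2| ≤ |δ.2| = |δ.1| + 1` exactly one inequality is strict, and by one. -/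
theorem Incident.cases {δ ρ : Finset T × Finset I} (h : Incident δ ρ)
    (hδ : δ.2.card = δ.1.card + 1) (hρ : ρ.1.card = ρ.2.card) :
    (δ.1 = ρ.1 ∧ ∃ k ∉ ρ.2, δ.2 = insert k ρ.2) ∨
      (δ.2 = ρ.2 ∧ ∃ x ∉ δ.1, ρ.1 = insert x δ.1) := by
  have h1 := Finset.card_le_card h.1
  have h2 := Finset.card_le_card h.2
  by_cases hc : δ.1.card = ρ.1.card
  · refine Or.inl ⟨Finset.eq_of_subset_of_card_le h.1 hc.ge, ?_⟩
    have h3 : (δ.2 \ ρ.2).card = 1 := by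
      rw [Finset.card_sdiff_of_subset h.2]; omega
    obtain ⟨k, hk⟩ := Finset.card_eq_one.1 h3
    have hk' : k ∈ δ.2 \ ρ.2 := by simp [hk]
    refine ⟨k, (Finset.mem_sdiff.1 hk').2, ?_⟩
    rw [Finset.insert_eq, ← hk, Finset.sdiff_union_of_subset h.2]
  · refine Or.inr ⟨(Finset.eq_of_subset_of_card_le h.2 (by omega)).symm, ?_⟩
    have h3 : (ρ.1 \ δ.1).card = 1 := by
      rw [Finset.card_sdiff_of_subset h.1]; omega
    obtain ⟨k, hk⟩ := Finset.card_eq_one.1 h3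
    have hk' : k ∈ ρ.1 \ δ.1 := by simp [hk]
    refine ⟨k, (Finset.mem_sdiff.1 hk').2, ?_⟩
    rw [Finset.insert_eq, ← hk, Finset.sdiff_union_of_subset h.1]

/-- `ρ` arises from the door `(τ, D)` by giving up the direction `k`, or by adding a point that
becomes the minimum in direction `k` only. -/
def Replaces (r : I → T → L) (τ : Finset T) (D : Finset I) (μ : I → T) (k : I)
    (ρ : Finset T × Finset I) : Prop :=
  IsRoom r ρ ∧ (ρ = (τ, D.erase k) ∨
    ∃ x ∉ τ, ρ = (insert x τ, D) ∧ ∀ l ∈ D, l ≠ k → r l (μ l) < r l x)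

/-! ### The two rooms at a nonempty door. -/

section Door

variable {r : I → T → L} (hr : ∀ l, Function.Injective (r l)) {τ : Finset T} {D : Finset I}
  (hd : IsDoor r (τ, D)) {μ : I → T} (hμ : ∀ l, μ l ∈ τ ∧ ∀ x ∈ τ, r l (μ l) ≤ r l x)

-- A point above all minima except the one in direction `k` rules out dominance without `k`. Of two
-- such points, dominance of each enlarged set puts the other no higher in direction `k`, so they
-- coincide.
include hr hμ in
theorem Replaces.unique {k : I} {ρ ρ' : Finset T × Finset I}
    (h : Replaces r τ D μ k ρ) (h' : Replaces r τ D μ k ρ') : ρ = ρ' := by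
  have key : ∀ x, Dominant r τ (D.erase k) → ¬ ∀ l ∈ D, l ≠ k → r l (μ l) < r l x := by
    intro x hdom hx
    obtain ⟨l, hl, h1⟩ := hdom x
    exact absurd (h1 _ (hμ l).1) (not_le.2 (hx l (Finset.mem_of_mem_erase hl)
      (Finset.ne_of_mem_erase hl)))
  have key2 : ∀ x x', Dominant r (insert x τ) D →
      (∀ l ∈ D, l ≠ k → r l (μ l) < r l x') → r k x' ≤ r k x := by
    intro x x' hdom hx'
    obtain ⟨l, hl, h1⟩ := hdom x'
    by_cases hlk : l = k
    · subst hlk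
      exact h1 x (Finset.mem_insert_self _ _)
    · exact absurd (h1 _ (Finset.mem_insert_of_mem (hμ l).1)) (not_le.2 (hx' l hl hlk))
  obtain ⟨⟨hdom, -⟩, rfl | ⟨x, hx, rfl, hx1⟩⟩ := h <;>
    obtain ⟨⟨hdom', -⟩, rfl | ⟨x', hx', rfl, hx1'⟩⟩ := h'
  · rfl
  · exact absurd hx1' (key x' hdom)
  · exact absurd hx1 (key x hdom')
  · rw [hr k (le_antisymm (key2 x' x hdom' hx1) (key2 x x' hdom hx1'))]

-- Among the points above the minima in all directions of `D` but `k`, the highest in direction `k`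
-- can be added. If there are none, direction `k` is superfluous.
include hr hd hμ in
theorem exists_replaces [Finite T] {k k' : I} (hk : k ∈ D) (hk' : k' ∈ D) (hne : k' ≠ k)
    (hkk : μ k = μ k') : ∃ ρ, Replaces r τ D μ k ρ := by
  obtain ⟨hdom, hcard⟩ := hd
  by_cases hM : ∃ x, ∀ l ∈ D, l ≠ k → r l (μ l) < r l x
  · obtain ⟨x, hx, hmax⟩ := Set.exists_max_image {x | ∀ l ∈ D, l ≠ k → r l (μ l) < r l x}
      (r k) (Set.toFinite _) hM
    have hxτ : x ∉ τ := by
      intro hxτ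
      obtain ⟨l, hl, rfl⟩ := hdom.exists_argmin_eq hr hμ hxτ
      by_cases hlk : l = k
      · subst hlk
        rw [hkk] at hx
        exact lt_irrefl _ (hx k' hk' hne)
      · exact lt_irrefl _ (hx l hl hlk)
    refine ⟨(insert x τ, D), ⟨fun y => ?_, ?_⟩, Or.inr ⟨x, hxτ, rfl, hx⟩⟩
    · have hxk : r k x ≤ r k (μ k) := by
        obtain ⟨l, hl, h1⟩ := hdom x
        by_cases hlk : l = k
        · subst hlk
          exact h1 _ (hμ l).1
        · exact absurd (h1 _ (hμ l).1) (not_le.2 (hx l hl hlk))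
      by_cases hy : ∀ l ∈ D, l ≠ k → r l (μ l) < r l y
      · refine ⟨k, hk, fun z hz => (hmax y hy).trans ?_⟩
        rcases Finset.mem_insert.1 hz with rfl | hz
        · exact le_rfl
        · exact hxk.trans ((hμ k).2 z hz)
      · push Not at hy
        obtain ⟨l, hl, hlk, hly⟩ := hy
        refine ⟨l, hl, fun z hz => hly.trans ?_⟩
        rcases Finset.mem_insert.1 hz with rfl | hz
        · exact (hx l hl hlk).le
        · exact (hμ l).2 z hz
    · simp only [Finset.card_insert_of_notMem hxτ]
      exact hcard.symm
  · push Not at hM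
    refine ⟨(τ, D.erase k), ⟨fun y => ?_, ?_⟩, Or.inl rfl⟩
    · obtain ⟨l, hl, hlk, h1⟩ := hM y
      exact ⟨l, Finset.mem_erase.2 ⟨hlk, hl⟩, fun x hx => h1.trans ((hμ l).2 x hx)⟩
    · simp only [Finset.card_erase_of_mem hk]
      simp only at hcard
      omega

-- A point added for both `k` and `k'` would exceed the minima in every direction of `D`, against
-- dominance of the door.
include hd hμ in
theorem Replaces.ne {k k' : I} (hk : k ∈ D) (hk' : k' ∈ D) (hne : k' ≠ k)
    {ρ ρ' : Finset T × Finset I}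
    (h : Replaces r τ D μ k ρ) (h' : Replaces r τ D μ k' ρ') : ρ ≠ ρ' := by
  intro heq
  subst heq
  have hE : ∀ j ∈ D, D ≠ D.erase j := fun j hj hD => by
    rw [hD] at hj
    exact Finset.notMem_erase _ _ hj
  obtain ⟨-, rfl | ⟨x, hx, rfl, hx1⟩⟩ := h <;>
    obtain ⟨-, h2 | ⟨x', hx', h2, hx1'⟩⟩ := h'
  · have h3 := (Prod.ext_iff.1 h2).2
    have : k' ∈ D.erase k := Finset.mem_erase.2 ⟨hne, hk'⟩
    simp only at h3
    rw [h3] at this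
    exact Finset.notMem_erase _ _ this
  · exact hE k hk (Prod.ext_iff.1 h2).2.symm
  · exact hE k' hk' (Prod.ext_iff.1 h2).2
  · have h3 : insert x τ = insert x' τ := (Prod.ext_iff.1 h2).1
    have h4 : x = x' := by
      have : x ∈ insert x' τ := h3 ▸ Finset.mem_insert_self _ _
      exact (Finset.mem_insert.1 this).resolve_right hx
    subst h4
    obtain ⟨l, hl, h5⟩ := hd.1 x
    have h6 := h5 _ (hμ l).1
    by_cases hlk : l = k
    · exact absurd h6 (not_le.2 (hx1' l hl (by rw [hlk]; exact hne.symm)))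
    · exact absurd h6 (not_le.2 (hx1 l hl hlk))

-- Directions of a room have distinct minimizers, so passing to a room must separate `k` from `k'`:
-- one of them is dropped, or the new point becomes the minimizer of one of them.
include hr hd hμ in
theorem IsRoom.replaces {k k' : I} (hk : k ∈ D) (hk' : k' ∈ D) (hne : k' ≠ k)
    (hkk : μ k = μ k') {ρ : Finset T × Finset I} (hρ : IsRoom r ρ) (hi : Incident (τ, D) ρ) :
    Replaces r τ D μ k ρ ∨ Replaces r τ D μ k' ρ := by
  obtain ⟨σ, C⟩ := ρ
  rcases hi.cases hd.2 hρ.2 with ⟨h1, j, hj, h2⟩ | ⟨h1, x, hx, h2⟩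
  · simp only at h1 h2 hj
    subst h1 h2
    have hinj := hρ.1.injOn_argmin hr hρ.2 hμ
    have hC : (insert j C).erase j = C := Finset.erase_insert hj
    by_cases h3 : k = j
    · subst h3
      exact Or.inl ⟨hρ, Or.inl (by rw [hC])⟩
    · by_cases h4 : k' = j
      · subst h4
        exact Or.inr ⟨hρ, Or.inl (by rw [hC])⟩
      · exact absurd (hinj ((Finset.mem_insert.1 hk).resolve_left h3)
          ((Finset.mem_insert.1 hk').resolve_left h4) hkk).symm hne
  · simp only at h1 h2 hx
    subst h1 h2
    obtain ⟨ν, hν⟩ := exists_argmin r (Finset.insert_nonempty x τ)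
    have hinj := hρ.1.injOn_argmin hr hρ.2 hν
    have hν' : ∀ l, ν l ≠ x → ν l = μ l := by
      intro l hl
      have h3 := (Finset.mem_insert.1 (hν l).1).resolve_left hl
      exact hr l (le_antisymm ((hν l).2 _ (Finset.mem_insert_of_mem (hμ l).1)) ((hμ l).2 _ h3))
    have main : ∀ j ∈ D, ν j = x → Replaces r τ D μ j (insert x τ, D) := by
      intro j hj hjx
      refine ⟨hρ, Or.inr ⟨x, hx, rfl, fun l hl hlj => ?_⟩⟩
      have h3 : ν l ≠ x := fun h => hlj (hinj hl hj (h.trans hjx.symm))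
      rw [← hν' l h3]
      exact lt_of_le_of_ne ((hν l).2 x (Finset.mem_insert_self _ _)) (fun h => h3 (hr l h))
    by_cases h3 : ν k = x
    · exact Or.inl (main k hk h3)
    · by_cases h4 : ν k' = x
      · exact Or.inr (main k' hk' h4)
      · exact absurd (hinj hk hk' (by rw [hν' k h3, hν' k' h4, hkk])).symm hne

theorem Replaces.incident {k : I} {ρ : Finset T × Finset I} (h : Replaces r τ D μ k ρ) :
    Incident (τ, D) ρ := by
  obtain ⟨-, rfl | ⟨x, hx, rfl, -⟩⟩ := h
  · exact ⟨subset_rfl, Finset.erase_subset _ _⟩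
  · exact ⟨Finset.subset_insert _ _, subset_rfl⟩

end Door

open Classical in
theorem card_rooms_of_door [Fintype T] [Fintype I] {r : I → T → L}
    (hr : ∀ l, Function.Injective (r l)) {τ : Finset T} {D : Finset I} (hd : IsDoor r (τ, D))
    (hτ : τ.Nonempty) :
    (Finset.univ.filter fun ρ => IsRoom r ρ ∧ Incident (τ, D) ρ).card = 2 := by
  obtain ⟨μ, hμ⟩ := exists_argmin r hτ
  -- A door has more directions than points, so two directions share a minimizer; resolving the
  -- clash at either one gives the two rooms.
  obtain ⟨k, hk, k', hk', hne, hkk⟩ := Finset.exists_ne_map_eq_of_card_lt_of_maps_to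
    (s := D) (t := τ) (f := μ) (by have := hd.2; simp only at this; omega)
    (fun l _ => (hμ l).1)
  obtain ⟨ρ, hρ⟩ := exists_replaces hr hd hμ hk hk' hne.symm hkk
  obtain ⟨ρ', hρ'⟩ := exists_replaces hr hd hμ hk' hk hne hkk.symm
  rw [Finset.card_eq_two]
  refine ⟨ρ, ρ', hρ.ne hd hμ hk hk' hne.symm hρ', ?_⟩
  ext ρ''
  simp only [Finset.mem_filter, Finset.mem_univ, true_and, Finset.mem_insert,
    Finset.mem_singleton]
  constructor
  · rintro ⟨h1, h2⟩
    exact (IsRoom.replaces hr hd hμ hk hk' hne.symm hkk h1 h2).imp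
      (fun h => h.unique hr hμ hρ) (fun h => h.unique hr hμ hρ')
  · rintro (rfl | rfl)
    · exact ⟨hρ.1, hρ.incident⟩
    · exact ⟨hρ'.1, hρ'.incident⟩

-- The only such room consists of the maximum in direction `i`. This is the one odd count in the
-- parity argument.
omit [DecidableEq T] [DecidableEq I] in
open Classical in
theorem card_rooms_of_empty_door [Fintype T] [Fintype I] [Nonempty T] {r : I → T → L}
    (hr : ∀ l, Function.Injective (r l)) (i : I) :
    (Finset.univ.filter fun ρ => IsRoom r ρ ∧ Incident (∅, {i}) ρ).card = 1 := by
  obtain ⟨m, -, hm⟩ := Finset.exists_max_image Finset.univ (r i) Finset.univ_nonempty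
  rw [Finset.card_eq_one]
  refine ⟨({m}, {i}), ?_⟩
  ext ⟨σ, C⟩
  simp only [Finset.mem_filter, Finset.mem_univ, true_and, Finset.mem_singleton]
  constructor
  · rintro ⟨⟨h1, h2⟩, -, h3⟩
    simp only at h1 h2 h3
    have hC : C = {i} := by
      rcases Finset.subset_singleton_iff.1 h3 with rfl | h
      · obtain ⟨l, hl, -⟩ := h1 m
        simp at hl
      · exact h
    subst hC
    obtain ⟨x, rfl⟩ := Finset.card_eq_one.1 (h2.trans (Finset.card_singleton i))
    obtain ⟨l, hl, h4⟩ := h1 m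
    rw [Finset.mem_singleton.1 hl] at h4
    rw [hr i (le_antisymm (h4 x (Finset.mem_singleton_self x)) (hm x (Finset.mem_univ x)))]
  · rintro h
    obtain ⟨rfl, rfl⟩ := Prod.ext_iff.1 h
    refine ⟨⟨fun y => ⟨i, by simp, fun x hx => ?_⟩, rfl⟩, by simp, by simp⟩
    rw [Finset.mem_singleton.1 hx]
    exact hm y (Finset.mem_univ y)

/-- The colors of the points of the door are its directions, except `i`. -/
def MissesOnly (c : T → I) (i : I) (δ : Finset T × Finset I) : Prop :=
  i ∈ δ.2 ∧ δ.1.image c = δ.2.erase i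

-- If there is any such door, there are exactly two. When `c` is injective on the room, one point
-- has a color outside the directions: either erase that point or add its color as a direction.
-- Otherwise two points share a color, and either may be erased.
open Classical in
theorem even_card_doors_of_room [Fintype T] [Fintype I] {r : I → T → L} {c : T → I} (i : I)
    {ρ : Finset T × Finset I} (hρ : IsRoom r ρ) (hc : ρ.1.image c ≠ ρ.2) :
    Even (Finset.univ.filter fun δ => (IsDoor r δ ∧ MissesOnly c i δ) ∧ Incident δ ρ).card := by
  obtain ⟨σ, C⟩ := ρ
  obtain ⟨hdom, hcard⟩ := hρ
  simp only at hc hdom hcard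
  by_cases hex : ∃ δ, (IsDoor r δ ∧ MissesOnly c i δ) ∧ Incident δ (σ, C)
  swap
  · rw [Finset.filter_false_of_mem (fun δ _ h => hex ⟨δ, h⟩)]
    simp
  have cases : ∀ δ : Finset T × Finset I, (IsDoor r δ ∧ MissesOnly c i δ) ∧ Incident δ (σ, C) →
      (∃ k ∉ C, k ≠ i ∧ i ∈ C ∧ δ = (σ, insert k C) ∧ σ.image c = insert k (C.erase i)) ∨
      (∃ x ∈ σ, c x ≠ i ∧ i ∈ C ∧ δ = (σ.erase x, C) ∧ (σ.erase x).image c = C.erase i) := by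
    rintro ⟨τ, D⟩ ⟨⟨hδ, hi, him⟩, hinc⟩
    rcases hinc.cases hδ.2 hcard with ⟨h1, j, hj, h2⟩ | ⟨h1, x, hx, h2⟩
    · simp only at h1 h2 hj him hi
      subst h1 h2
      have hji : j ≠ i := by
        rintro rfl
        rw [Finset.erase_insert hj] at him
        exact hc him
      refine Or.inl ⟨j, hj, hji, (Finset.mem_insert.1 hi).resolve_left hji.symm, rfl, ?_⟩
      rw [him, Finset.erase_insert_of_ne hji]
    · simp only at h1 h2 hx him hi
      subst h1 h2
      refine Or.inr ⟨x, Finset.mem_insert_self _ _, ?_, hi, ?_, ?_⟩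
      · intro hxi
        apply hc
        rw [Finset.image_insert, him, hxi, Finset.insert_erase hi]
      · rw [Finset.erase_insert hx]
      · rw [Finset.erase_insert hx, him]
  have of_insert : ∀ k ∉ C, i ∈ C → σ.image c = insert k (C.erase i) →
      (IsDoor r (σ, insert k C) ∧ MissesOnly c i (σ, insert k C)) ∧
        Incident (σ, insert k C) (σ, C) := by
    intro k hk hi h
    have hki : k ≠ i := fun h => hk (h ▸ hi)
    refine ⟨⟨⟨hdom.mono subset_rfl (Finset.subset_insert _ _), ?_⟩,
      Finset.mem_insert_of_mem hi, ?_⟩, subset_rfl, Finset.subset_insert _ _⟩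
    · simp only [Finset.card_insert_of_notMem hk, hcard]
    · simp only [h, Finset.erase_insert_of_ne hki]
  have of_erase : ∀ x ∈ σ, i ∈ C → (σ.erase x).image c = C.erase i →
      (IsDoor r (σ.erase x, C) ∧ MissesOnly c i (σ.erase x, C)) ∧
        Incident (σ.erase x, C) (σ, C) := by
    intro x hx hi h
    refine ⟨⟨⟨hdom.mono (Finset.erase_subset _ _) subset_rfl, ?_⟩, hi, h⟩,
      Finset.erase_subset _ _, subset_rfl⟩
    simp only [Finset.card_erase_of_mem hx, ← hcard]
    have := Finset.card_pos.2 ⟨x, hx⟩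
    omega
  have hcardE : i ∈ C → (C.erase i).card + 1 = σ.card := fun hi => by
    rw [Finset.card_erase_add_one hi, hcard]
  suffices h2 : (Finset.univ.filter fun δ =>
      (IsDoor r δ ∧ MissesOnly c i δ) ∧ Incident δ (σ, C)).card = 2 by
    rw [h2]
    exact even_two
  rw [Finset.card_eq_two]
  by_cases hinj : Set.InjOn c σ
  · have himc : (σ.image c).card = σ.card := Finset.card_image_iff.2 hinj
    obtain ⟨k, hk, hi, him⟩ : ∃ k ∉ C, i ∈ C ∧ σ.image c = insert k (C.erase i) := by
      obtain ⟨δ, hδ⟩ := hex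
      rcases cases δ hδ with ⟨k, hk, -, hi, -, him⟩ | ⟨x, hx, hxi, hi, -, him⟩
      · exact ⟨k, hk, hi, him⟩
      · have h1 : σ.image c = insert (c x) (C.erase i) := by
          rw [← him, ← Finset.image_insert, Finset.insert_erase hx]
        refine ⟨c x, fun hxC => ?_, hi, h1⟩
        rw [Finset.insert_eq_of_mem (Finset.mem_erase.2 ⟨hxi, hxC⟩)] at h1
        have := hcardE hi
        rw [← h1, himc] at this
        omega
    obtain ⟨x, hx, rfl⟩ : ∃ x ∈ σ, c x = k := by
      rw [← Finset.mem_image, him]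
      exact Finset.mem_insert_self _ _
    have hki : c x ≠ i := fun h => hk (h ▸ hi)
    have himx : (σ.erase x).image c = C.erase i := by
      ext l
      have h3 := Finset.ext_iff.1 him l
      simp only [Finset.mem_image, Finset.mem_insert] at h3
      simp only [Finset.mem_image]
      constructor
      · rintro ⟨y, hy, rfl⟩
        refine (h3.1 ⟨y, Finset.mem_of_mem_erase hy, rfl⟩).resolve_left fun h => ?_
        exact Finset.ne_of_mem_erase hy (hinj (Finset.mem_of_mem_erase hy) hx h)
      · intro hl
        obtain ⟨y, hy, rfl⟩ := h3.2 (Or.inr hl)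
        refine ⟨y, Finset.mem_erase.2 ⟨?_, hy⟩, rfl⟩
        rintro rfl
        exact hk (Finset.mem_of_mem_erase hl)
    refine ⟨(σ, insert (c x) C), (σ.erase x, C), ?_, ?_⟩
    · intro h
      have h4 : σ = σ.erase x := (Prod.ext_iff.1 h).1
      rw [h4] at hx
      exact Finset.notMem_erase _ _ hx
    ext δ
    simp only [Finset.mem_filter, Finset.mem_univ, true_and, Finset.mem_insert,
      Finset.mem_singleton]
    constructor
    · intro hδ
      rcases cases δ hδ with ⟨k', hk', -, -, h5, him'⟩ | ⟨x', hx', hxi', -, h5, him'⟩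
      · left
        rw [h5]
        have : c x ∈ insert k' (C.erase i) := by
          rw [← him', him]
          exact Finset.mem_insert_self _ _
        rw [(Finset.mem_insert.1 this).resolve_right fun h => hk (Finset.mem_of_mem_erase h)]
      · right
        rw [h5]
        by_cases hxx : x = x'
        · rw [hxx]
        · exfalso
          have : c x ∈ (σ.erase x').image c :=
            Finset.mem_image_of_mem _ (Finset.mem_erase.2 ⟨hxx, hx⟩)
          rw [him'] at this
          exact hk (Finset.mem_of_mem_erase this)
    · rintro (rfl | rfl)
      · exact of_insert _ hk hi him
      · exact of_erase _ hx hi himx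
  · have himc : (σ.image c).card < σ.card :=
      lt_of_le_of_ne Finset.card_image_le (fun h => hinj (Finset.card_image_iff.1 h))
    obtain ⟨hi, him⟩ : i ∈ C ∧ σ.image c = C.erase i := by
      obtain ⟨δ, hδ⟩ := hex
      rcases cases δ hδ with ⟨k, hk, -, hi, -, him⟩ | ⟨x, hx, hxi, hi, -, him⟩
      · have h6 := hcardE hi
        rw [him, Finset.card_insert_of_notMem fun h => hk (Finset.mem_of_mem_erase h)] at himc
        omega
      · refine ⟨hi, (Finset.eq_of_subset_of_card_le ?_ ?_).symm⟩
        · rw [← him]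
          exact Finset.image_subset_image (Finset.erase_subset _ _)
        · have := hcardE hi
          omega
    obtain ⟨x, hx, y, hy, hxy, hne⟩ : ∃ x ∈ σ, ∃ y ∈ σ, c x = c y ∧ x ≠ y := by
      simpa [Set.InjOn] using hinj
    have hmem : ∀ z ∈ σ, c z ∈ C.erase i := fun z hz => him ▸ Finset.mem_image_of_mem _ hz
    have himE : ∀ a b, b ∈ σ → c a = c b → a ≠ b → (σ.erase a).image c = C.erase i := by
      intro a b hb hab hne
      rw [← him]
      refine (Finset.image_subset_image (Finset.erase_subset _ _)).antisymm fun l hl => ?_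
      obtain ⟨z, hz, rfl⟩ := Finset.mem_image.1 hl
      by_cases hza : z = a
      · rw [hza, hab]
        exact Finset.mem_image_of_mem _ (Finset.mem_erase.2 ⟨hne.symm, hb⟩)
      · exact Finset.mem_image_of_mem _ (Finset.mem_erase.2 ⟨hza, hz⟩)
    have hinjE : ∀ a ∈ σ, (σ.erase a).image c = C.erase i → Set.InjOn c (σ.erase a) := by
      intro a ha h
      rw [← Finset.card_image_iff, h]
      have := hcardE hi
      rw [Finset.card_erase_of_mem ha]
      omega
    refine ⟨(σ.erase x, C), (σ.erase y, C), ?_, ?_⟩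
    · intro h
      have h4 : σ.erase x = σ.erase y := (Prod.ext_iff.1 h).1
      have : x ∈ σ.erase y := Finset.mem_erase.2 ⟨hne, hx⟩
      rw [← h4] at this
      exact Finset.notMem_erase _ _ this
    ext δ
    simp only [Finset.mem_filter, Finset.mem_univ, true_and, Finset.mem_insert,
      Finset.mem_singleton]
    constructor
    · intro hδ
      rcases cases δ hδ with ⟨k, hk, -, -, h5, him'⟩ | ⟨z, hz, hzi, -, h5, him'⟩
      · exfalso
        have : k ∈ C.erase i := by
          rw [← him, him']
          exact Finset.mem_insert_self _ _
        exact hk (Finset.mem_of_mem_erase this)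
      · have h7 := hinjE z hz him'
        by_cases hxz : x = z
        · left
          rw [h5, hxz]
        · by_cases hyz : y = z
          · right
            rw [h5, hyz]
          · exact absurd (h7 (Finset.mem_coe.2 (Finset.mem_erase.2 ⟨hxz, hx⟩))
              (Finset.mem_coe.2 (Finset.mem_erase.2 ⟨hyz, hy⟩)) hxy) hne
    · rintro (rfl | rfl)
      · exact of_erase _ hx hi (himE x y hy hxy hne)
      · exact of_erase _ hy hi (himE y x hx hxy.symm hne.symm)

/-- **Scarf's lemma**: some room has exactly its directions as colors. -/
theorem exists_colorful_room [Fintype T] [Fintype I] [Nonempty T] [Nonempty I] {r : I → T → L}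
    (hr : ∀ l, Function.Injective (r l)) (c : T → I) :
    ∃ ρ : Finset T × Finset I, IsRoom r ρ ∧ ρ.1.image c = ρ.2 := by
  classical
  by_contra! hno
  obtain ⟨i⟩ := ‹Nonempty I›
  set doors : Finset (Finset T × Finset I) :=
    Finset.univ.filter fun δ => IsDoor r δ ∧ MissesOnly c i δ with hdoors
  set rooms : Finset (Finset T × Finset I) := Finset.univ.filter fun ρ => IsRoom r ρ with hrooms
  -- Incidences are counted twice: without a colorful room the count by rooms is even, while the
  -- empty door makes the count by doors odd.
  have hcount := Finset.sum_card_bipartiteAbove_eq_sum_card_bipartiteBelow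
    (s := doors) (t := rooms) (Incident (T := T) (I := I))
  have hright : Even (∑ ρ ∈ rooms, (Finset.bipartiteBelow Incident doors ρ).card) := by
    refine Finset.even_sum _ fun ρ hρ => ?_
    rw [Finset.bipartiteBelow, hdoors, Finset.filter_filter]
    have hρ' : IsRoom r ρ := by simpa [hrooms] using hρ
    exact even_card_doors_of_room i hρ' (hno ρ hρ')
  have hmem : ((∅ : Finset T), ({i} : Finset I)) ∈ doors := by
    simp only [hdoors, Finset.mem_filter, Finset.mem_univ, true_and]
    refine ⟨⟨fun y => ⟨i, by simp, by simp⟩, by simp⟩, by simp, by simp⟩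
  have hleft : Odd (∑ δ ∈ doors, (Finset.bipartiteAbove Incident rooms δ).card) := by
    rw [← Finset.add_sum_erase _ _ hmem]
    refine Odd.add_even ?_ (Finset.even_sum _ fun δ hδ => ?_)
    · rw [Finset.bipartiteAbove, hrooms, Finset.filter_filter, card_rooms_of_empty_door hr]
      exact odd_one
    · rw [Finset.bipartiteAbove, hrooms, Finset.filter_filter]
      obtain ⟨τ, D⟩ := δ
      obtain ⟨hne, h⟩ := Finset.mem_erase.1 hδ
      obtain ⟨h1, hi, -⟩ := (Finset.mem_filter.1 h).2
      rw [card_rooms_of_door hr h1]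
      · exact even_two
      · rw [Finset.nonempty_iff_ne_empty]
        rintro rfl
        obtain ⟨k, hk⟩ := Finset.card_eq_one.1 h1.2
        simp only at hk
        subst hk
        exact hne (by rw [Finset.mem_singleton.1 hi])
  rw [hcount] at hleft
  exact (Nat.not_even_iff_odd.2 hleft) hright

end Scarf

/-! ### From grids to complementarity and Ky Fan's inequality. -/

open Filter Topology
/-- Grid points of the simplex with step `1 / N`. -/
abbrev SimplexGrid (ι : Type*) [Fintype ι] (N : ℕ) : Type _ :=
  {a : ι → Fin (N + 1) // ∑ i, (a i : ℕ) = N}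

namespace SimplexGrid

variable {ι : Type*} [Fintype ι] {N : ℕ}

theorem exists_extension [DecidableEq ι] {C : Finset ι} (hC : C.Nonempty) {m : ι → ℕ}
    (h : ∑ i ∈ C, m i ≤ N) : ∃ a : SimplexGrid ι N, ∀ i ∈ C, m i ≤ a.1 i := by
  obtain ⟨i₀, hi₀⟩ := hC
  -- All slack is put on `i₀`, so that the total is exactly `N`.
  set b : ι → ℕ := fun i => (if i ∈ C then m i else 0) +
    (if i = i₀ then N - ∑ i ∈ C, m i else 0) with hb
  have hsum : ∑ i, b i = N := by
    simp only [hb, Finset.sum_add_distrib, Finset.sum_ite_mem, Finset.univ_inter,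
      Finset.sum_ite_eq', Finset.mem_univ, if_true]
    omega
  have hle : ∀ i, b i < N + 1 := fun i => by
    have := Finset.single_le_sum (f := b) (fun _ _ => Nat.zero_le _) (Finset.mem_univ i)
    omega
  refine ⟨⟨fun i => ⟨b i, hle i⟩, hsum⟩, fun i hi => ?_⟩
  simp [hb, hi]

/-- For every coloring of the grid by coordinates, some grid point is close to points of all those
colors for which its coordinate is not small. -/
theorem exists_near_colors [Nonempty ι] (c : SimplexGrid ι N → ι) :
    ∃ a : SimplexGrid ι N, ∀ m, (a.1 m : ℕ) ≤ Fintype.card ι ∨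
      ∃ a', c a' = m ∧ ∀ l, (a.1 l : ℕ) ≤ a'.1 l + Fintype.card ι ∧
        (a'.1 l : ℕ) ≤ a.1 l + Fintype.card ι := by
  classical
  have hne : Nonempty (SimplexGrid ι N) := by
    obtain ⟨a, -⟩ := exists_extension (ι := ι) (N := N) (m := 0) Finset.univ_nonempty (by simp)
    exact ⟨a⟩
  let e := Fintype.equivFin (SimplexGrid ι N)
  -- The enumeration `e` breaks ties, making each coordinate order injective.
  let r : ι → SimplexGrid ι N → ℕ ×ₗ Fin (Fintype.card (SimplexGrid ι N)) :=
    fun i a => toLex ((a.1 i : ℕ), e a)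
  have hr : ∀ i, Function.Injective (r i) := fun i a b h =>
    e.injective (Prod.ext_iff.1 (toLex.injective h)).2
  have hr_lt : ∀ i a b, (a.1 i : ℕ) < b.1 i → r i a < r i b := fun i a b h =>
    Prod.Lex.lt_iff.2 (Or.inl h)
  obtain ⟨⟨σ, C⟩, ⟨hdom, hcard⟩, him⟩ := Scarf.exists_colorful_room hr c
  simp only at hdom hcard him
  have hC : C.Nonempty := by
    obtain ⟨l, hl, -⟩ := hdom hne.some
    exact ⟨l, hl⟩
  have hσ : σ.Nonempty := by
    rw [← Finset.card_pos, hcard]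
    exact hC.card_pos
  obtain ⟨μ, hμ⟩ := Scarf.exists_argmin r hσ
  have hμ_le : ∀ l, ∀ x ∈ σ, ((μ l).1 l : ℕ) ≤ x.1 l := fun l x hx => by
    by_contra! h
    exact absurd ((hμ l).2 x hx) (not_le.2 (hr_lt l _ _ h))
  -- Otherwise some grid point would exceed every minimum by at least one, against dominance.
  have hbig : N < ∑ l ∈ C, (((μ l).1 l : ℕ) + 1) := by
    by_contra! h
    obtain ⟨y, hy⟩ := exists_extension hC h
    obtain ⟨l, hl, h1⟩ := hdom y
    exact absurd (h1 _ (hμ l).1) (not_le.2 (hr_lt l _ _ (hy l hl)))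
  have hCn : C.card ≤ Fintype.card ι := Finset.card_le_univ C
  -- Coordinates of `x` sum to `N`, so by `hbig` the excess over the minima plus the mass outside
  -- `C` is below `|C|`. Hence the room is small.
  have hsum : ∀ x ∈ σ, (∑ l ∈ C, ((x.1 l : ℕ) - (μ l).1 l)) + ∑ l ∈ Cᶜ, (x.1 l : ℕ) < C.card := by
    intro x hx
    have h1 := x.2
    rw [← Finset.sum_add_sum_compl C] at h1
    have h2 : ∑ l ∈ C, ((x.1 l : ℕ) - (μ l).1 l) + ∑ l ∈ C, ((μ l).1 l : ℕ) =
        ∑ l ∈ C, (x.1 l : ℕ) := by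
      rw [← Finset.sum_add_distrib]
      exact Finset.sum_congr rfl fun l _ => Nat.sub_add_cancel (hμ_le l x hx)
    rw [Finset.sum_add_distrib, Finset.sum_const, smul_eq_mul, mul_one] at hbig
    omega
  have hin : ∀ x ∈ σ, ∀ l ∈ C, (x.1 l : ℕ) ≤ (μ l).1 l + Fintype.card ι := by
    intro x hx l hl
    have h1 := Finset.single_le_sum (f := fun l => (x.1 l : ℕ) - (μ l).1 l)
      (fun _ _ => Nat.zero_le _) hl
    have h2 := hsum x hx
    omega
  have hout : ∀ x ∈ σ, ∀ l ∉ C, (x.1 l : ℕ) ≤ Fintype.card ι := by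
    intro x hx l hl
    have h1 := Finset.single_le_sum (f := fun l => (x.1 l : ℕ))
      (fun _ _ => Nat.zero_le _) (Finset.mem_compl.2 hl)
    have h2 := hsum x hx
    omega
  have hdist : ∀ x ∈ σ, ∀ y ∈ σ, ∀ l, (x.1 l : ℕ) ≤ y.1 l + Fintype.card ι := by
    intro x hx y hy l
    by_cases hl : l ∈ C
    · exact (hin x hx l hl).trans (Nat.add_le_add_right (hμ_le l y hy) _)
    · exact (hout x hx l hl).trans (Nat.le_add_left _ _)
  obtain ⟨a, ha⟩ := hσ
  refine ⟨a, fun m => ?_⟩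
  by_cases hm : m ∈ C
  · rw [← him] at hm
    obtain ⟨a', ha', rfl⟩ := Finset.mem_image.1 hm
    exact Or.inr ⟨a', rfl, fun l => ⟨hdist a ha a' ha' l, hdist a' ha' a ha l⟩⟩
  · exact Or.inl (hout a ha m hm)

/-- A grid point as a point of the standard simplex. -/
noncomputable def toSimplex (hN : 0 < N) (a : SimplexGrid ι N) : stdSimplex ℝ ι :=
  ⟨fun i => (a.1 i : ℕ) / (N : ℝ), fun i => by positivity, by
    rw [← Finset.sum_div, ← Nat.cast_sum, a.2]
    exact div_self (by positivity)⟩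

end SimplexGrid

/-- Nonlinear complementarity on the standard simplex, an equivalent of Brouwer's theorem. -/
theorem exists_stdSimplex_complementarity {ι : Type*} [Fintype ι] [Nonempty ι]
    {g : stdSimplex ℝ ι → ι → ℝ} (hg : ∀ m, Continuous fun x => g x m) :
    ∃ x : stdSimplex ℝ ι, ∀ m, 0 < x.1 m → ∀ k, g x k ≤ g x m := by
  have happrox : ∀ n : ℕ, ∃ x : stdSimplex ℝ ι, ∀ m,
      x.1 m ≤ Fintype.card ι / ((n : ℝ) + 1) ∨ ∃ x' : stdSimplex ℝ ι, (∀ k, g x' k ≤ g x' m) ∧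
        ∀ l, |x'.1 l - x.1 l| ≤ Fintype.card ι / ((n : ℝ) + 1) := by
    intro n
    have hmax : ∀ x : stdSimplex ℝ ι, ∃ m, ∀ k, g x k ≤ g x m := fun x => by
      obtain ⟨m, -, hm⟩ := Finset.exists_max_image Finset.univ (g x) Finset.univ_nonempty
      exact ⟨m, fun k => hm k (Finset.mem_univ k)⟩
    -- A point is colored by a coordinate at which `g` is largest.
    choose c hc using hmax
    obtain ⟨a, ha⟩ := SimplexGrid.exists_near_colors (N := n + 1)
      fun a : SimplexGrid ι (n + 1) => c (a.toSimplex n.succ_pos)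
    have hn : (0 : ℝ) < (n : ℝ) + 1 := by positivity
    refine ⟨a.toSimplex n.succ_pos, fun m => (ha m).imp (fun h => ?_) ?_⟩
    · simp only [SimplexGrid.toSimplex, Nat.cast_succ]
      gcongr
    · rintro ⟨a', rfl, h⟩
      refine ⟨a'.toSimplex n.succ_pos, hc _, fun l => ?_⟩
      simp only [SimplexGrid.toSimplex, Nat.cast_succ]
      rw [← sub_div, abs_div, abs_of_pos hn]
      gcongr
      obtain ⟨h1, h2⟩ := h l
      rw [abs_le]
      have h1' : ((a.1 l : ℕ) : ℝ) ≤ (a'.1 l : ℕ) + Fintype.card ι := by exact_mod_cast h1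
      have h2' : ((a'.1 l : ℕ) : ℝ) ≤ (a.1 l : ℕ) + Fintype.card ι := by exact_mod_cast h2
      constructor <;> linarith
  choose x hx using happrox
  have : CompactSpace (stdSimplex ℝ ι) := isCompact_iff_compactSpace.1 (isCompact_stdSimplex ℝ ι)
  obtain ⟨z, φ, hφ, hz⟩ := CompactSpace.tendsto_subseq x
  have hε : Tendsto (fun n => (Fintype.card ι : ℝ) / ((φ n : ℝ) + 1)) atTop (𝓝 0) :=
    (tendsto_const_nhds.div_atTop
      (tendsto_atTop_add_const_right _ _ tendsto_natCast_atTop_atTop)).comp hφ.tendsto_atTop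
  have hcoord : ∀ l, Tendsto (fun n => (x (φ n)).1 l) atTop (𝓝 (z.1 l)) := fun l =>
    (((continuous_apply l).comp continuous_subtype_val).tendsto z).comp hz
  refine ⟨z, fun m hm k => ?_⟩
  -- A coordinate positive in the limit eventually exceeds the vanishing threshold, so points of
  -- color `m` occur arbitrarily close to `z`.
  have hev : ∀ᶠ n in atTop, ∃ x' : stdSimplex ℝ ι, (∀ k, g x' k ≤ g x' m) ∧
      ∀ l, |x'.1 l - (x (φ n)).1 l| ≤ Fintype.card ι / ((φ n : ℝ) + 1) := by
    filter_upwards [hε.eventually_lt (hcoord m) hm] with n hn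
    exact (hx (φ n) m).resolve_left (not_le.2 hn)
  obtain ⟨y, hy⟩ := hev.choice
  have hylim : Tendsto y atTop (𝓝 z) := by
    rw [tendsto_subtype_rng, tendsto_pi_nhds]
    intro l
    have h1 : Tendsto (fun n => (y n).1 l - (x (φ n)).1 l) atTop (𝓝 0) := by
      refine squeeze_zero_norm' ?_ hε
      filter_upwards [hy] with n hn
      exact hn.2 l
    simpa using h1.add (hcoord l)
  exact le_of_tendsto_of_tendsto (((hg k).tendsto z).comp hylim) (((hg m).tendsto z).comp hylim)
    (hy.mono fun n hn => hn.1 k)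

/-- Ky Fan's inequality, for a space with mixtures of finite families. -/
theorem exists_forall_le_zero_of_mixtures {X : Type} [TopologicalSpace X] [CompactSpace X]
    [Nonempty X] {φ : X → X → ℝ} (hcont : ∀ t, Continuous fun x => φ x t) (hdiag : ∀ x, φ x x ≤ 0)
    (hmix : ∀ (ι : Type) [Fintype ι] (t : ι → X), ∃ s : stdSimplex ℝ ι → X, Continuous s ∧
      ∀ w x, ∑ m, w.1 m * φ x (t m) ≤ φ x (s w)) :
    ∃ x, ∀ t, φ x t ≤ 0 := by
  by_contra! hno
  obtain ⟨F, hF⟩ := isCompact_univ.elim_finite_subcover (fun t => {x | 0 < φ x t})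
    (fun t => isOpen_lt continuous_const (hcont t))
    (fun x _ => Set.mem_iUnion.2 (hno x))
  have hF' : ∀ x, ∃ m : F, 0 < φ x m := fun x => by
    obtain ⟨t, ht, hx⟩ := Set.mem_iUnion₂.1 (hF (Set.mem_univ x))
    exact ⟨⟨t, ht⟩, hx⟩
  have : Nonempty F := ⟨(hF' (Classical.arbitrary X)).choose⟩
  obtain ⟨s, hs, hsφ⟩ := hmix F (fun m => m.1)
  -- Here `w` charges only maximizers of `φ (s w)` over `F`, so the weighted mean is at least the
  -- positive value at `k`, yet at most `φ (s w) (s w) ≤ 0`.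
  obtain ⟨w, hw⟩ := exists_stdSimplex_complementarity (g := fun w (m : F) => φ (s w) m)
    fun m => (hcont m).comp hs
  obtain ⟨k, hk⟩ := hF' (s w)
  have h1 : φ (s w) k ≤ ∑ m : F, w.1 m * φ (s w) m := by
    calc φ (s w) k = ∑ m : F, w.1 m * φ (s w) k := by
          rw [← Finset.sum_mul, w.2.2, one_mul]
      _ ≤ _ := by
          refine Finset.sum_le_sum fun m _ => ?_
          rcases (w.2.1 m).eq_or_lt with h | h
          · rw [← h, zero_mul, zero_mul]
          · exact mul_le_mul_of_nonneg_left (hw m h k) h.le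
  have h2 := hsφ w (s w)
  have h3 := hdiag (s w)
  linarith

/-! ### Players and profiles. -/

namespace Player

theorem opp_ne (i : Player) : i.opp ≠ i := by cases i <;> simp [opp]

theorem forall_iff (i : Player) {P : Player → Prop} : (∀ k, P k) ↔ P i ∧ P i.opp := by
  constructor
  · exact fun h => ⟨h _, h _⟩
  · rintro ⟨h1, h2⟩ k
    cases i <;> cases k <;> assumption

theorem exists_pair {P : Player → Type*} (i : Player) (a : P i) (b : P i.opp) :
    ∃ p : ∀ k, P k, p i = a ∧ p i.opp = b := by
  cases i
  · exact ⟨fun k => match k with | one => a | two => b, rfl, rfl⟩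
  · exact ⟨fun k => match k with | one => b | two => a, rfl, rfl⟩

/-- `i.opp.opp` reduces to `i` only once `i` is a constructor, so equalities are transported by
cases. -/
theorem apply_opp_opp {P : Player → Type*} {i : Player} {p q : ∀ k, P k} (h : p i = q i) :
    p i.opp.opp = q i.opp.opp := by
  cases i <;> exact h

end Player

/-! ### Compactness, mixtures, best replies and Stackelberg profiles. -/

namespace Game

variable (G : Game)

instance instCompactSpaceStrategy (i : Player) : CompactSpace (G.Strategy i) := by
  cases G with
  | finite F => exact isCompact_iff_compactSpace.1 (isCompact_stdSimplex ℝ (F.Act i))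
  | interval I => exact isCompact_iff_compactSpace.1 (isCompact_Icc (a := I.lo i) (b := I.hi i))

instance instNonemptyStrategy (i : Player) : Nonempty (G.Strategy i) := by
  classical
  cases G with
  | finite F =>
    exact ⟨⟨_, single_mem_stdSimplex ℝ (Classical.arbitrary (F.Act i))⟩⟩
  | interval I => exact ⟨⟨_, Set.left_mem_Icc.2 (I.lo_le_hi i)⟩⟩

theorem continuous_payoff (i : Player) :
    Continuous fun p : G.Strategy i × G.Strategy i.opp => G.payoff i p.1 p.2 := by
  cases G with
  | finite F =>
    change Continuous fun p : stdSimplex ℝ (F.Act i) × stdSimplex ℝ (F.Act i.opp) =>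
      ∑ a, ∑ b, p.1.1 a * p.2.1 b * F.u i a b
    refine continuous_finsetSum _ fun a _ => continuous_finsetSum _ fun b _ => ?_
    have h1 : Continuous fun p : stdSimplex ℝ (F.Act i) × stdSimplex ℝ (F.Act i.opp) => p.1.1 a :=
      (continuous_apply a).comp (continuous_subtype_val.comp continuous_fst)
    have h2 : Continuous fun p : stdSimplex ℝ (F.Act i) × stdSimplex ℝ (F.Act i.opp) => p.2.1 b :=
      (continuous_apply b).comp (continuous_subtype_val.comp continuous_snd)
    exact (h1.mul h2).mul continuous_const
  | interval I =>
    change Continuous fun p : Set.Icc (I.lo i) (I.hi i) × Set.Icc (I.lo i.opp) (I.hi i.opp) =>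
      I.u i p.1.1 p.2.1
    exact (I.contDiff_u i).continuousOn.comp_continuous
      ((continuous_subtype_val.comp continuous_fst).prodMk
        (continuous_subtype_val.comp continuous_snd)) fun p => ⟨p.1.2, p.2.2⟩

theorem continuous_payoff_comp {X : Type*} [TopologicalSpace X] {i : Player}
    {f : X → G.Strategy i} {g : X → G.Strategy i.opp} (hf : Continuous f) (hg : Continuous g) :
    Continuous fun x => G.payoff i (f x) (g x) :=
  (G.continuous_payoff i).comp (hf.prodMk hg)

/-- Mixtures of finitely many strategies, which pay at least the mixture of the payoffs. -/
theorem exists_mixture (i : Player) {ι : Type} [Fintype ι] (t : ι → G.Strategy i) :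
    ∃ s : stdSimplex ℝ ι → G.Strategy i, Continuous s ∧
      ∀ w y, ∑ m, w.1 m * G.payoff i (t m) y ≤ G.payoff i (s w) y := by
  have hcoord : ∀ m, Continuous fun w : stdSimplex ℝ ι => w.1 m := fun m =>
    (continuous_apply m).comp continuous_subtype_val
  cases G with
  | finite F =>
    change ι → stdSimplex ℝ (F.Act i) at t
    refine ⟨fun w => (⟨∑ m, w.1 m • (t m).1, (convex_stdSimplex ℝ (F.Act i)).sum_mem
      (fun m _ => w.2.1 m) w.2.2 fun m _ => (t m).2⟩ : stdSimplex ℝ (F.Act i)), ?_, ?_⟩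
    · exact Continuous.subtype_mk
        (continuous_finsetSum _ fun m _ => (hcoord m).smul continuous_const) _
    · intro w (y : stdSimplex ℝ (F.Act i.opp))
      change ∑ m, w.1 m * ∑ a, ∑ b, (t m).1 a * y.1 b * F.u i a b ≤
        ∑ a, ∑ b, (∑ m, w.1 m • (t m).1) a * y.1 b * F.u i a b
      refine le_of_eq ?_
      simp only [Finset.sum_apply, Pi.smul_apply, smul_eq_mul, Finset.sum_mul, Finset.mul_sum]
      rw [Finset.sum_comm]
      refine Finset.sum_congr rfl fun a _ => ?_
      rw [Finset.sum_comm]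
      refine Finset.sum_congr rfl fun b _ => Finset.sum_congr rfl fun m _ => ?_
      ring
  | interval I =>
    change ι → Set.Icc (I.lo i) (I.hi i) at t
    refine ⟨fun w => (⟨∑ m, w.1 m • (t m).1, (convex_Icc (I.lo i) (I.hi i)).sum_mem
      (fun m _ => w.2.1 m) w.2.2 fun m _ => (t m).2⟩ : Set.Icc (I.lo i) (I.hi i)), ?_, ?_⟩
    · exact Continuous.subtype_mk
        (continuous_finsetSum _ fun m _ => (hcoord m).smul continuous_const) _
    · intro w (y : Set.Icc (I.lo i.opp) (I.hi i.opp))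
      exact (I.concave_u i y.1 y.2).le_map_sum (fun m _ => w.2.1 m) w.2.2 fun m _ => (t m).2

theorem monotoneMap_id (j : Player) : G.MonotoneMap j id := by
  cases G with
  | finite F =>
    intro s t a α h0 h1 hne _ c hc
    change t.1 c ≤ s.1 c
    rw [hne c hc]
    nlinarith [s.2.1 c]
  | interval I => exact fun _ _ h => h

theorem monotoneMap_of_const {j : Player} {f : G.Strategy j → G.Strategy j}
    (hf : ∀ y y', f y = f y') : G.MonotoneMap j f := by
  cases G with
  | finite F =>
    intro s t a α _ _ _ _ c _
    rw [hf t s]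
  | interval I =>
    intro s t _
    exact le_of_eq (α := Set.Icc (I.lo j) (I.hi j)) (hf s t)

theorem bestReplies_nonempty (i : Player) (y : G.Strategy i.opp) :
    (G.bestReplies i y).Nonempty := by
  obtain ⟨x, -, hx⟩ := isCompact_univ.exists_isMaxOn Set.univ_nonempty
    (G.continuous_payoff_comp (i := i) continuous_id (continuous_const (y := y))).continuousOn
  exact ⟨x, fun x' => hx (Set.mem_univ x')⟩

theorem isClosed_bestReplies (i : Player) :
    IsClosed {q : G.Strategy i × G.Strategy i.opp | q.1 ∈ G.bestReplies i q.2} := by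
  change IsClosed {q : G.Strategy i × G.Strategy i.opp |
    ∀ x', G.payoff i x' q.2 ≤ G.payoff i q.1 q.2}
  rw [Set.ofPred_forall]
  exact isClosed_iInter fun x' => isClosed_le
    (G.continuous_payoff_comp continuous_const continuous_snd) (G.continuous_payoff i)

variable {G}

theorem mem_opponentReplies {i : Player} {s : G.Profile} :
    s i.opp ∈ G.opponentReplies i (s i) ↔ s i.opp ∈ G.bestReplies i.opp (s i.opp.opp) := by
  constructor
  · rintro ⟨p, h1, -, h2⟩
    rwa [Player.apply_opp_opp h1] at h2
  · exact fun h => ⟨s, rfl, rfl, h⟩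

variable (G)

theorem opponentReplies_nonempty (i : Player) (x : G.Strategy i) :
    (G.opponentReplies i x).Nonempty := by
  obtain ⟨p, rfl, -⟩ := Player.exists_pair i x (Classical.arbitrary (G.Strategy i.opp))
  obtain ⟨y, hy⟩ := G.bestReplies_nonempty i.opp (p i.opp.opp)
  obtain ⟨q, h1, rfl⟩ := Player.exists_pair i (p i) y
  refine ⟨q i.opp, q, h1, rfl, ?_⟩
  rwa [Player.apply_opp_opp h1]

/-- A profile of an undominated Stackelberg strategy and a favourable reply to it. -/
theorem exists_stackelberg_profile (i : Player) : ∃ s : G.Profile,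
    G.IsUndominatedStackelberg i (s i) ∧ G.IsFavourableReply i (s i) (s i.opp) := by
  -- The extra coordinate records a strategy to which `s i` is a best reply, so undominatedness
  -- becomes a closed condition. One maximization over `K` selects both the Stackelberg strategy and
  -- the favourable reply.
  set K : Set (G.Profile × G.Strategy i.opp) := {q | q.1 i ∈ G.bestReplies i q.2} ∩
    {q | q.1 i.opp ∈ G.bestReplies i.opp (q.1 i.opp.opp)} with hK
  have hproj : ∀ k, Continuous fun q : G.Profile × G.Strategy i.opp => q.1 k := fun k =>
    (continuous_apply k).comp continuous_fst
  have hclosed : IsClosed K :=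
    ((G.isClosed_bestReplies i).preimage ((hproj i).prodMk continuous_snd)).inter
      ((G.isClosed_bestReplies i.opp).preimage ((hproj i.opp).prodMk (hproj i.opp.opp)))
  have hmem : ∀ x z, x ∈ G.bestReplies i z → ∀ y ∈ G.opponentReplies i x,
      ∃ s : G.Profile, s i = x ∧ s i.opp = y ∧ (s, z) ∈ K := by
    rintro x z hx y ⟨s, rfl, rfl, hs⟩
    exact ⟨s, rfl, rfl, hx, hs⟩
  have hne : K.Nonempty := by
    let z := Classical.arbitrary (G.Strategy i.opp)
    obtain ⟨x, hx⟩ := G.bestReplies_nonempty i z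
    obtain ⟨y, hy⟩ := G.opponentReplies_nonempty i x
    obtain ⟨s, -, -, hs⟩ := hmem x z hx y hy
    exact ⟨_, hs⟩
  obtain ⟨⟨s, z⟩, ⟨hs, hs'⟩, hmax⟩ := hclosed.isCompact.exists_isMaxOn hne
    (G.continuous_payoff_comp (hproj i) (hproj i.opp)).continuousOn
  have hle : ∀ x z, x ∈ G.bestReplies i z → ∀ y ∈ G.opponentReplies i x,
      G.payoff i x y ≤ G.payoff i (s i) (s i.opp) := by
    intro x z hx y hy
    obtain ⟨s', rfl, rfl, h⟩ := hmem x z hx y hy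
    exact hmax h
  have hopp : s i.opp ∈ G.opponentReplies i (s i) := mem_opponentReplies.2 hs'
  refine ⟨s, ⟨⟨z, hs⟩, _, ⟨⟨_, hopp, rfl⟩, ?_⟩, ?_⟩, hopp, hle _ z hs⟩
  · rintro _ ⟨y, hy, rfl⟩
    exact hle _ z hs y hy
  · rintro x ⟨z', hx⟩ _ ⟨y, hy, rfl⟩
    exact hle x z' hx y hy

/-! ### Equilibria of biased games and the biased-belief equilibrium. -/

variable {G}

theorem mem_NE {ψ : ∀ k, G.Belief k} {s : G.Profile} :
    s ∈ NE ψ ↔ ∀ k, s k ∈ G.bestReplies k (ψ k (s k.opp)) := Iff.rfl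

theorem NE_nonempty (ψ : ∀ k, G.Belief k) : (NE ψ).Nonempty := by
  classical
  have hb : ∀ (k : Player) {f : G.Profile → G.Strategy k}, Continuous f →
      Continuous fun s : G.Profile => biasedPayoff ψ k (f s) (s k.opp) := fun k f hf =>
    G.continuous_payoff_comp hf ((ψ k).continuous.comp (continuous_apply k.opp))
  -- The Nikaido–Isoda function: total gain from replacing each own strategy in `s` by that in `t`.
  -- If it is nowhere positive, unilateral changes `t` give the Nash conditions.
  let φ : G.Profile → G.Profile → ℝ := fun s t =>
    (biasedPayoff ψ .one (t .one) (s .two) + biasedPayoff ψ .two (t .two) (s .one)) -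
    (biasedPayoff ψ .one (s .one) (s .two) + biasedPayoff ψ .two (s .two) (s .one))
  obtain ⟨s, hs⟩ := exists_forall_le_zero_of_mixtures (φ := φ)
    (fun t => ((hb .one continuous_const).add (hb .two continuous_const)).sub
      ((hb .one (continuous_apply _)).add (hb .two (continuous_apply _))))
    (fun s => (sub_self _).le)
    (by
      intro ι _ t
      choose m hm hmle using fun k => G.exists_mixture k fun l => t l k
      refine ⟨fun w k => m k w, continuous_pi hm, fun w s => ?_⟩
      have h1 := hmle .one w (ψ .one (s .two))
      have h2 := hmle .two w (ψ .two (s .one))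
      simp only [φ, biasedPayoff, mul_sub, mul_add, Finset.sum_sub_distrib,
        Finset.sum_add_distrib, ← Finset.sum_mul, w.2.2, one_mul]
      linarith)
  refine ⟨s, fun k x => ?_⟩
  have h := hs (Function.update s k x)
  cases k
  · have h2 : Function.update s Player.one x Player.two = s Player.two :=
      Function.update_of_ne (by simp) _ _
    simp only [φ, Function.update_self, h2] at h
    change biasedPayoff ψ .one x (s .two) ≤ biasedPayoff ψ .one (s .one) (s .two)
    linarith
  · have h2 : Function.update s Player.two x Player.one = s Player.one :=
      Function.update_of_ne (by simp) _ _
    simp only [φ, Function.update_self, h2] at h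
    change biasedPayoff ψ .two x (s .one) ≤ biasedPayoff ψ .two (s .two) (s .one)
    linarith

theorem mem_undominated_of_mem_NE_update {ψ : ∀ k, G.Belief k} {i : Player}
    (hψ : ψ i.opp = ContinuousMap.id _) (b : G.Belief i) {s : G.Profile}
    (hs : s ∈ NE (Function.update ψ i b)) :
    s i ∈ G.undominated i ∧ s i.opp ∈ G.opponentReplies i (s i) := by
  refine ⟨⟨_, mem_NE.1 hs i⟩, mem_opponentReplies.2 ?_⟩
  have h := mem_NE.1 hs i.opp
  rwa [Function.update_of_ne i.opp_ne, hψ] at h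

theorem IsUndominatedStackelberg.payoff_le {i : Player} {s s' : G.Profile}
    (h : G.IsUndominatedStackelberg i (s i)) (h' : G.IsFavourableReply i (s i) (s i.opp))
    (hs' : s' i ∈ G.undominated i) (ho : s' i.opp ∈ G.opponentReplies i (s' i)) :
    G.payoff i (s' i) (s' i.opp) ≤ G.payoff i (s i) (s i.opp) := by
  obtain ⟨-, v, ⟨⟨y, hy, rfl⟩, -⟩, hv⟩ := h
  exact (hv _ hs' _ ⟨_, ho, rfl⟩).trans (h'.2 y hy)

/-- An implausible equilibrium comes with another in which the opponent keeps his original strategy,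
and that one is plausible. -/
theorem PNE_nonempty {ψ : ∀ k, G.Belief k} {s : G.Profile} {i : Player} {b : G.Belief i} :
    (PNE ψ s i b).Nonempty := by
  obtain ⟨s', hs'⟩ := NE_nonempty (Function.update ψ i b)
  by_cases h : IsImplausible ψ s i b s'
  · exact ⟨_, h.2.2, fun h' => h'.2.1 (Function.update_self ..).symm⟩
  · exact ⟨s', hs', h⟩

/-- If a player with a blind belief plays a best reply to the perceived strategy, every deviation
of the opponent admits a plausible equilibrium in which that player does not react. -/
theorem exists_mem_PNE_of_blind {ψ : ∀ k, G.Belief k} {s : G.Profile} {i : Player}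
    (hψ : IsBlind (ψ i)) (hs : s i ∈ G.bestReplies i (ψ i (s i.opp))) (b : G.Belief i.opp) :
    ∃ s' ∈ PNE ψ s i.opp b, s' i = s i := by
  obtain ⟨z, hz⟩ := G.bestReplies_nonempty i.opp (b (s i.opp.opp))
  obtain ⟨s', h1, rfl⟩ := Player.exists_pair i (s i) z
  refine ⟨s', ⟨mem_NE.2 ((Player.forall_iff i).2 ⟨?_, ?_⟩), fun h => ?_⟩, h1⟩
  · rw [Function.update_of_ne i.opp_ne.symm, h1, hψ (s' i.opp) (s i.opp)]
    exact hs
  · rw [Function.update_self, Player.apply_opp_opp h1]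
    exact hz
  · exact h.2.1 (Player.apply_opp_opp h1).symm

/-- Own deviations are bounded in all equilibria by Stackelberg optimality. Deviations of the
opponent are harmless as long as `i` stays at `s i`, which blindness permits and uniqueness
enforces. -/
theorem isBBE_of_stackelberg {ψ : ∀ k, G.Belief k} {s : G.Profile} {i : Player}
    (hs : G.IsUndominatedStackelberg i (s i)) (hs' : G.IsFavourableReply i (s i) (s i.opp))
    (hblind : IsBlind (ψ i)) (hid : ψ i.opp = ContinuousMap.id _)
    (hbr : s i ∈ G.bestReplies i (ψ i (s i.opp))) :
    IsBBE ψ s ∧ (G.bestReplies i (ψ i (s i.opp)) = {s i} → IsStrongBBE ψ s) := by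
  have hopp : s i.opp ∈ G.bestReplies i.opp (s i.opp.opp) := mem_opponentReplies.1 hs'.1
  have hNE : s ∈ NE ψ := mem_NE.2 ((Player.forall_iff i).2 ⟨hbr, by rw [hid]; exact hopp⟩)
  have hmono : ∀ k, G.MonotoneMap k.opp (ψ k) := by
    refine (Player.forall_iff i).2 ⟨G.monotoneMap_of_const hblind, ?_⟩
    rw [hid]
    exact G.monotoneMap_id _
  have hown : ∀ b : G.Belief i, ∀ s' ∈ NE (Function.update ψ i b),
      G.payoff i (s' i) (s' i.opp) ≤ G.payoff i (s i) (s i.opp) := fun b s' h =>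
    let ⟨h1, h2⟩ := mem_undominated_of_mem_NE_update hid b h
    hs.payoff_le hs' h1 h2
  have hother : ∀ s' : G.Profile, s' i = s i →
      G.payoff i.opp (s' i.opp) (s' i.opp.opp) ≤ G.payoff i.opp (s i.opp) (s i.opp.opp) := by
    intro s' h
    rw [Player.apply_opp_opp h]
    exact hopp _
  have hPNE : ∀ (k : Player) (b : G.Belief k), ∃ s' ∈ PNE ψ s k b,
      G.payoff k (s' k) (s' k.opp) ≤ G.payoff k (s k) (s k.opp) := by
    refine (Player.forall_iff i).2 ⟨fun b => ?_, fun b => ?_⟩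
    · obtain ⟨s', h⟩ := PNE_nonempty (ψ := ψ) (s := s) (b := b)
      exact ⟨s', h, hown b s' h.1⟩
    · obtain ⟨s', h, h1⟩ := exists_mem_PNE_of_blind hblind hbr b
      exact ⟨s', h, hother s' h1⟩
  have hweak : IsWeakBBE ψ s := ⟨hNE, fun k b =>
    let ⟨s', h, h1⟩ := hPNE k b
    ⟨s', h.1, h1⟩⟩
  refine ⟨⟨hweak, hmono, hPNE⟩, fun huniq => ⟨hweak, hmono, ?_⟩⟩
  refine (Player.forall_iff i).2 ⟨hown, fun b s' h => hother s' ?_⟩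
  have h1 := mem_NE.1 h i
  rw [Function.update_of_ne i.opp_ne.symm, hblind (s' i.opp) (s i.opp), huniq] at h1
  exact h1

theorem exists_beliefs_of_stackelberg {s : G.Profile} {i : Player}
    (hs : G.IsUndominatedStackelberg i (s i)) (hs' : G.IsFavourableReply i (s i) (s i.opp)) :
    ∃ ψ : ∀ k, G.Belief k, IsBlind (ψ i) ∧ ψ i.opp = ContinuousMap.id _ ∧ IsBBE ψ s ∧
      ((∃ y : G.Strategy i.opp, G.bestReplies i y = {s i}) → IsStrongBBE ψ s) := by
  -- The perceived strategy is one with `s i` as its only best reply whenever such a strategy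
  -- exists.
  obtain ⟨y, hy, huniq⟩ : ∃ y, s i ∈ G.bestReplies i y ∧
      ((∃ y, G.bestReplies i y = {s i}) → G.bestReplies i y = {s i}) := by
    by_cases h : ∃ y, G.bestReplies i y = {s i}
    · obtain ⟨y, hy⟩ := h
      exact ⟨y, by rw [hy]; rfl, fun _ => hy⟩
    · obtain ⟨y, hy⟩ := hs.1
      exact ⟨y, hy, fun h' => absurd h' h⟩
  obtain ⟨ψ, h1, h2⟩ := Player.exists_pair (P := G.Belief) i (ContinuousMap.const _ y)
    (ContinuousMap.id _)
  have hval : ∀ z, ψ i z = y := fun z => by rw [h1]; rfl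
  have hblind : IsBlind (ψ i) := fun z z' => by rw [hval, hval]
  obtain ⟨h3, h4⟩ := isBBE_of_stackelberg hs hs' hblind h2 (by rwa [hval])
  rw [hval] at h4
  exact ⟨ψ, hblind, h2, h3, fun h => h4 (huniq h)⟩

end Game

theorem proposition6 (G : Game) (i : Player) :
    (∃ (ψ : ∀ k, G.Belief k) (s : G.Profile),
      G.IsUndominatedStackelberg i (s i) ∧ G.IsFavourableReply i (s i) (s i.opp) ∧
      Game.IsBlind (ψ i) ∧ ψ i.opp = ContinuousMap.id _ ∧ Game.IsBBE ψ s) ∧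
    (∀ s : G.Profile,
      G.IsUndominatedStackelberg i (s i) → G.IsFavourableReply i (s i) (s i.opp) →
      ∃ ψ : ∀ k, G.Belief k,
        Game.IsBlind (ψ i) ∧ ψ i.opp = ContinuousMap.id _ ∧ Game.IsBBE ψ s ∧
        ((∃ y : G.Strategy i.opp, G.bestReplies i y = {s i}) → Game.IsStrongBBE ψ s)) := by
  refine ⟨?_, fun s hs hs' => Game.exists_beliefs_of_stackelberg hs hs'⟩
  obtain ⟨s, hs, hs'⟩ := G.exists_stackelberg_profile i
  obtain ⟨ψ, h1, h2, h3, -⟩ := Game.exists_beliefs_of_stackelberg hs hs'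
  exact ⟨ψ, s, hs, hs', h1, h2, h3⟩
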